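/- Let $X$ be a set. All $F$-inverse monoids are considered in the signature $(\cdot,1,{}^{-1},{}^{\mathfrak m})$, where $s^{\mathfrak m}$ is the greatest element of the $\sigma$-class of $s$ in the natural partial order and $\sigma$ is the minimum group congruence ($s\mathrel\sigma t$ iff $s,t$ have a common lower bound). "$X$-generated" refers to this signature (for groups, ${}^{\mathfrak m}$ is the identity), and a map between $X$-generated structures is canonical if it respects the generators. A term is a formal expression $w=u_0v_1^{\mathfrak m}u_1\cdots v_n^{\mathfrak m}u_n$ with $u_i,v_i$ words over $X\cup X^{-1}$; $w_S$ is its value in $S$. For an $X$-generated group $G$, the Cayley graph $\Gamma_X$ has vertex set $G$ and an edge labeled $a$ from $g$ to $ga_G$ for all $g\in G$, $a\in X\cup X^{-1}$; the inverse of this edge is the edge labeled $a^{-1}$ from $ga_G$ to $g$. $\operatorname{Sub}\Gamma_X$ is the lattice of subgraphs (sets of vertices and edges closed under end vertices and inverse edges, including the empty subgraph $\emptyset$), on which $G$ acts by left translation. A term $w$ as above labels the journey starting at $g$ that alternately traverses the paths labeled $u_i$ and jumps from the current vertex $h$ to $h(v_{i+1})_G$; it ends at $gw_G$. Denote by $\langle\overline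 w\rangle$ the subgraph spanned by its paths when $g=1$. A closure operator $c$ on $(\operatorname{Sub}\Gamma_X,\subseteq)$ is $G$-invariant if $(g\Delta)^c=g(\Delta^c)$ for all $g\in G$ and all subgraphs $\Delta$, and finitary if $\Delta^c=\bigcup\{F^c: F\subseteq\Delta\text{ finite}\}$ for all $\Delta$; a subgraph is compact if it is the closure of a finite subgraph. For an $X$-generated $F$-inverse monoid $S$ with greatest group image $G=S/\sigma$, let $c_S$ be the ($G$-invariant) closure operator on $\operatorname{Sub}\Gamma_X$ for which $\Delta$ is closed iff for all terms $u,v$ with $u_S=v_S$ and all vertices $g,h$ of $\Delta$, $u$ labels a journey from $g$ to $h$ in $\Delta$ iff $v$ does. Put $F\Gamma(w)=\langle\overline w\rangle^{c_S}$ for a term $w$, and $F\Gamma(s)=F\Gamma(w)$ for any term $w$ with $w_S=s$. For a $G$-invariant closure operator $c$ on $\operatorname{Sub}\Gamma_X$, let $S_c$ be the $F$-inverse monoid of all pairs $(\Delta,g)$ with $g\in G$ and $\Delta$ a compact subgraph containing $1$ and $g$, with operations $(\Delta,g)(\Xi,h)=((\Delta\cup g\Xi)^c,gh)$, $(\Delta,g)^{-1}=(g^{-1}\Delta,g^{-1})$,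 $(\Delta,g)^{\mathfrak m}=(\{1,g\}^c,g)$, identity $(\{1\}^c,1)$ and generators $x\mapsto(\langle\overline x\rangle^c,x_G)$. **Proposition.** 1. For every $X$-generated $F$-inverse monoid $S$ with greatest group image $G$, $F\Gamma(s)$ is well defined, and the map $\psi\colon S\to S_{c_S}$, $s\mapsto(F\Gamma(s),s\sigma)$ is a canonical isomorphism of $F$-inverse monoids. 2. For every $X$-generated group $G$ and every $G$-invariant, finitary closure operator $c$ on $(\operatorname{Sub}\Gamma_X,\subseteq)$, $S_c$ is an $X$-generated $F$-inverse monoid with greatest group image $G$ via $(\Delta,g)\mapsto g$, and $\Delta^c=\Delta^{c_{S_c}}$ for every non-empty subgraph $\Delta$ of $\Gamma_X$. Moreover, if $\emptyset^c=\emptyset$, then $c=c_{S_c}$. -/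

import Mathlib

universe u v w

namespace FInv

/-! ### Inverse monoids and `F`-inverse monoids -/

/-- Inverse monoids: monoids in which every element `a` has a unique inverse `a⁻¹`
in the sense of semigroup theory. -/
class InverseMonoid (S : Type v) extends Monoid S, Inv S where
  mul_inv_mul : ∀ a : S, a * a⁻¹ * a = a
  inv_mul_inv : ∀ a : S, a⁻¹ * a * a⁻¹ = a⁻¹
  inv_unique : ∀ a b : S, a * b * a = a → b * a * b = b → b = a⁻¹

/-- The natural partial order of an inverse monoid. -/
def NatLE {S : Type v} [InverseMonoid S] (a b : S) : Prop := a = a * a⁻¹ * b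

/-- The relation `σ` on an inverse monoid (the minimum group congruence): two elements are related
if and only if they have a common lower bound in the natural partial order. -/
def SigmaRel {S : Type v} [InverseMonoid S] (a b : S) : Prop := ∃ r : S, NatLE r a ∧ NatLE r b

/-- `F`-inverse monoids in the extended signature: `mx s` (written `s^𝔪`) is the greatest element
of the `σ`-class of `s` in the natural partial order. -/
class FInverseMonoid (S : Type v) extends InverseMonoid S where
  mx : S → S
  sigma_mx : ∀ s : S, SigmaRel s (mx s)
  le_mx : ∀ s t : S, SigmaRel s t → NatLE t (mx s)

/-- `S` is generated by `ι(X)` as an `F`-inverse monoid: the only subset of `S` that contains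
`ι(X)` and is closed under `1`, multiplication, inversion and `(·)^𝔪` is `S` itself. -/
def Generates {X : Type u} {S : Type v} [FInverseMonoid S] (ι : X → S) : Prop :=
  ∀ T : Set S, (∀ x, ι x ∈ T) → 1 ∈ T → (∀ a ∈ T, ∀ b ∈ T, a * b ∈ T) → (∀ a ∈ T, a⁻¹ ∈ T) →
    (∀ a ∈ T, FInverseMonoid.mx a ∈ T) → ∀ s, s ∈ T

/-- `π` exhibits the group `G` as the greatest group image `S/σ` of `S`. -/
def IsGreatestGroupImage {S : Type v} [InverseMonoid S] {G : Type w} [Group G] (π : S →* G) :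
    Prop :=
  Function.Surjective π ∧ ∀ s t : S, π s = π t ↔ SigmaRel s t

/-! ### Words and terms -/

/-- Words over `X ∪ X⁻¹`; the letter `(x, true)` is `x` and `(x, false)` is `x⁻¹`. -/
abbrev Word (X : Type u) := List (X × Bool)

/-- The formal expressions `u₀ v₁^𝔪 u₁ ⋯ vₙ^𝔪 uₙ` with `uᵢ`, `vᵢ` words over `X ∪ X⁻¹`:
`word u` is the expression `u`, and `jump u v t` is the expression `u v^𝔪 t`. -/
inductive FTerm (X : Type u) : Type u
  | word (a : Word X) : FTerm X
  | jump (a b : Word X) (t : FTerm X) : FTerm X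

/-- The value of a letter under an assignment of the generators. -/
def letter {X : Type u} {M : Type v} [Inv M] (ι : X → M) (a : X × Bool) : M :=
  if a.2 then ι a.1 else (ι a.1)⁻¹

/-- The value of a word under an assignment of the generators. -/
def wordVal {X : Type u} {M : Type v} [Monoid M] [Inv M] (ι : X → M) : Word X → M
  | [] => 1
  | a :: p => letter ι a * wordVal ι p

/-- The value `w_S` of a term `w` in an `F`-inverse monoid `S`. -/
def FTerm.val {X : Type u} {S : Type v} [FInverseMonoid S] (ι : X → S) : FTerm X → S
  | .word a => wordVal ι a
  | .jump a b t => wordVal ι a * FInverseMonoid.mx (wordVal ι b) * t.val ι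

/-- The value `w_G` of a term `w` in a group `G`, where `(·)^𝔪` is the identity map. -/
def FTerm.groupVal {X : Type u} {G : Type w} [Group G] (ι : X → G) : FTerm X → G
  | .word a => wordVal ι a
  | .jump a b t => wordVal ι a * wordVal ι b * t.groupVal ι

/-! ### The Cayley graph and its subgraphs

The Cayley graph of a group `G` with respect to `ι : X → G` has vertex set `G` and one edge
`(g, a)` from `g` to `g a_G` for each vertex `g` and each letter `a` of `X ∪ X⁻¹`. -/

/-- The edges of the Cayley graph: pairs (initial vertex, label). -/
abbrev Edge (X : Type u) (G : Type w) := G × (X × Bool)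

/-- The terminal vertex of an edge. -/
def Edge.tgt {X : Type u} {G : Type w} [Group G] (ι : X → G) (e : Edge X G) : G :=
  e.1 * letter ι e.2

/-- The inverse of an edge. -/
def Edge.rev {X : Type u} {G : Type w} [Group G] (ι : X → G) (e : Edge X G) : Edge X G :=
  (Edge.tgt ι e, (e.2.1, !e.2.2))

theorem letter_not {X : Type u} {G : Type w} [Group G] (ι : X → G) (a : X × Bool) :
    letter ι (a.1, !a.2) = (letter ι a)⁻¹ := by
  obtain ⟨x, b⟩ := a
  cases b <;> simp [letter]

theorem Edge.tgt_rev {X : Type u} {G : Type w} [Group G] (ι : X → G) (e : Edge X G) :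
    Edge.tgt ι (Edge.rev ι e) = e.1 := by
  simp [Edge.tgt, Edge.rev, letter_not]

theorem Edge.rev_rev {X : Type u} {G : Type w} [Group G] (ι : X → G) (e : Edge X G) :
    Edge.rev ι (Edge.rev ι e) = e := by
  refine Prod.ext (Edge.tgt_rev ι e) ?_
  simp [Edge.rev]

/-- Subgraphs of the Cayley graph: sets of vertices and edges closed under taking initial
vertices, terminal vertices and inverse edges. The empty subgraph is included. -/
@[ext]
structure Subgr {X : Type u} {G : Type w} [Group G] (ι : X → G) where
  verts : Set G
  edges : Set (Edge X G)
  src_mem : ∀ e ∈ edges, e.1 ∈ verts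
  tgt_mem : ∀ e ∈ edges, Edge.tgt ι e ∈ verts
  rev_mem : ∀ e ∈ edges, Edge.rev ι e ∈ edges

section Subgraphs

variable {X : Type u} {G : Type w} [Group G] {ι : X → G}

/-- Subgraphs are ordered by inclusion. -/
instance : PartialOrder (Subgr ι) where
  le Δ Ξ := Δ.verts ⊆ Ξ.verts ∧ Δ.edges ⊆ Ξ.edges
  le_refl _ := ⟨subset_rfl, subset_rfl⟩
  le_trans _ _ _ h k := ⟨h.1.trans k.1, h.2.trans k.2⟩
  le_antisymm _ _ h k := Subgr.ext (h.1.antisymm k.1) (h.2.antisymm k.2)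

/-- Subgraphs form a complete lattice under union and intersection. -/
instance : CompleteLattice (Subgr ι) where
  sup Δ Ξ :=
    { verts := Δ.verts ∪ Ξ.verts
      edges := Δ.edges ∪ Ξ.edges
      src_mem := fun e h => h.imp (Δ.src_mem e) (Ξ.src_mem e)
      tgt_mem := fun e h => h.imp (Δ.tgt_mem e) (Ξ.tgt_mem e)
      rev_mem := fun e h => h.imp (Δ.rev_mem e) (Ξ.rev_mem e) }
  inf Δ Ξ :=
    { verts := Δ.verts ∩ Ξ.verts
      edges := Δ.edges ∩ Ξ.edges
      src_mem := fun e h => ⟨Δ.src_mem e h.1, Ξ.src_mem e h.2⟩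
      tgt_mem := fun e h => ⟨Δ.tgt_mem e h.1, Ξ.tgt_mem e h.2⟩
      rev_mem := fun e h => ⟨Δ.rev_mem e h.1, Ξ.rev_mem e h.2⟩ }
  sSup A :=
    { verts := {g | ∃ Δ ∈ A, g ∈ Δ.verts}
      edges := {e | ∃ Δ ∈ A, e ∈ Δ.edges}
      src_mem := fun e ⟨Δ, hA, h⟩ => ⟨Δ, hA, Δ.src_mem e h⟩
      tgt_mem := fun e ⟨Δ, hA, h⟩ => ⟨Δ, hA, Δ.tgt_mem e h⟩
      rev_mem := fun e ⟨Δ, hA, h⟩ => ⟨Δ, hA, Δ.rev_mem e h⟩ }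
  sInf A :=
    { verts := {g | ∀ Δ ∈ A, g ∈ Δ.verts}
      edges := {e | ∀ Δ ∈ A, e ∈ Δ.edges}
      src_mem := fun e h Δ hA => Δ.src_mem e (h Δ hA)
      tgt_mem := fun e h Δ hA => Δ.tgt_mem e (h Δ hA)
      rev_mem := fun e h Δ hA => Δ.rev_mem e (h Δ hA) }
  top := ⟨Set.univ, Set.univ, fun _ _ => trivial, fun _ _ => trivial, fun _ _ => trivial⟩
  bot := ⟨∅, ∅, fun _ h => h.elim, fun _ h => h.elim, fun _ h => h.elim⟩
  le_sup_left _ _ := ⟨Set.subset_union_left, Set.subset_union_left⟩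
  le_sup_right _ _ := ⟨Set.subset_union_right, Set.subset_union_right⟩
  sup_le _ _ _ h k := ⟨Set.union_subset h.1 k.1, Set.union_subset h.2 k.2⟩
  inf_le_left _ _ := ⟨Set.inter_subset_left, Set.inter_subset_left⟩
  inf_le_right _ _ := ⟨Set.inter_subset_right, Set.inter_subset_right⟩
  le_inf _ _ _ h k := ⟨Set.subset_inter h.1 k.1, Set.subset_inter h.2 k.2⟩
  isLUB_sSup _ :=
    ⟨fun Δ hA => ⟨fun _ h => ⟨Δ, hA, h⟩, fun _ h => ⟨Δ, hA, h⟩⟩,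
      fun _ hb => ⟨fun _ ⟨_, hA, h⟩ => (hb hA).1 h, fun _ ⟨_, hA, h⟩ => (hb hA).2 h⟩⟩
  isGLB_sInf _ :=
    ⟨fun Δ hA => ⟨fun _ h => h Δ hA, fun _ h => h Δ hA⟩,
      fun _ hb => ⟨fun _ h _ hA => (hb hA).1 h, fun _ h _ hA => (hb hA).2 h⟩⟩
  le_top _ := ⟨fun _ _ => trivial, fun _ _ => trivial⟩
  bot_le _ := ⟨fun _ h => h.elim, fun _ h => h.elim⟩

/-- A subgraph is finite if it has finitely many vertices and edges. -/
def Subgr.IsFinite (Δ : Subgr ι) : Prop := Δ.verts.Finite ∧ Δ.edges.Finite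

/-- The left action of `G` on the subgraphs of its Cayley graph:
`g Δ` has vertices `g h` with `h` in `Δ` and edges `(g h, a)` with `(h, a)` in `Δ`. -/
instance : MulAction G (Subgr ι) where
  smul g Δ :=
    { verts := {h | g⁻¹ * h ∈ Δ.verts}
      edges := {e | (g⁻¹ * e.1, e.2) ∈ Δ.edges}
      src_mem := fun _ h => Δ.src_mem _ h
      tgt_mem := fun e h => by
        have := Δ.tgt_mem _ h
        simpa [Edge.tgt, mul_assoc] using this
      rev_mem := fun e h => by
        have := Δ.rev_mem _ h
        simpa [Edge.rev, Edge.tgt, mul_assoc] using this }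
  one_smul Δ := by
    refine Subgr.ext (Set.ext fun h => ?_) (Set.ext fun e => ?_)
    · change 1⁻¹ * h ∈ Δ.verts ↔ _
      simp
    · change (1⁻¹ * e.1, e.2) ∈ Δ.edges ↔ _
      simp
  mul_smul g k Δ := by
    refine Subgr.ext (Set.ext fun h => ?_) (Set.ext fun e => ?_)
    · change (g * k)⁻¹ * h ∈ Δ.verts ↔ k⁻¹ * (g⁻¹ * h) ∈ Δ.verts
      simp [mul_assoc]
    · change ((g * k)⁻¹ * e.1, e.2) ∈ Δ.edges ↔ (k⁻¹ * (g⁻¹ * e.1), e.2) ∈ Δ.edges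
      simp [mul_assoc]

theorem Subgr.mem_verts_smul {g h : G} {Δ : Subgr ι} : h ∈ (g • Δ).verts ↔ g⁻¹ * h ∈ Δ.verts :=
  Iff.rfl

theorem Subgr.mem_edges_smul {g : G} {e : Edge X G} {Δ : Subgr ι} :
    e ∈ (g • Δ).edges ↔ (g⁻¹ * e.1, e.2) ∈ Δ.edges :=
  Iff.rfl

theorem Subgr.smul_mono (g : G) {Δ Ξ : Subgr ι} (h : Δ ≤ Ξ) : g • Δ ≤ g • Ξ :=
  ⟨fun _ k => h.1 k, fun _ k => h.2 k⟩

theorem Subgr.smul_le_iff {g : G} {Δ Ξ : Subgr ι} : g • Δ ≤ Ξ ↔ Δ ≤ g⁻¹ • Ξ := by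
  constructor
  · intro h
    simpa using Subgr.smul_mono g⁻¹ h
  · intro h
    simpa using Subgr.smul_mono g h

theorem Subgr.smul_sup (g : G) (Δ Ξ : Subgr ι) : g • (Δ ⊔ Ξ) = g • Δ ⊔ g • Ξ := rfl

theorem Subgr.IsFinite.sup {Δ Ξ : Subgr ι} (h : Δ.IsFinite) (k : Ξ.IsFinite) : (Δ ⊔ Ξ).IsFinite :=
  ⟨h.1.union k.1, h.2.union k.2⟩

theorem Subgr.IsFinite.smul {Δ : Subgr ι} (h : Δ.IsFinite) (g : G) : (g • Δ).IsFinite := by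
  constructor
  · exact h.1.preimage (mul_right_injective g⁻¹).injOn
  · refine h.2.preimage (f := fun e : Edge X G => (g⁻¹ * e.1, e.2)) (Function.Injective.injOn ?_)
    rintro ⟨a, b⟩ ⟨a', b'⟩ hab
    simpa using hab

variable (ι)

/-- The subgraph with the single vertex `g` and no edges. -/
def Subgr.vert (g : G) : Subgr ι where
  verts := {g}
  edges := ∅
  src_mem := fun _ h => h.elim
  tgt_mem := fun _ h => h.elim
  rev_mem := fun _ h => h.elim

/-- The subgraph consisting of the edge `e`, its inverse, and its end vertices. -/
def Subgr.edge (e : Edge X G) : Subgr ι where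
  verts := {e.1, Edge.tgt ι e}
  edges := {e, Edge.rev ι e}
  src_mem := by
    rintro _ (rfl | rfl)
    · exact Or.inl rfl
    · exact Or.inr rfl
  tgt_mem := by
    rintro _ (rfl | rfl)
    · exact Or.inr rfl
    · exact Or.inl (Edge.tgt_rev ι e)
  rev_mem := by
    rintro _ (rfl | rfl)
    · exact Or.inr rfl
    · exact Or.inl (Edge.rev_rev ι e)

/-- The subgraph spanned by the path labeled by a given word and starting at `g`. -/
def pathSpan (g : G) : Word X → Subgr ι
  | [] => Subgr.vert ι g
  | a :: p => Subgr.edge ι (g, a) ⊔ pathSpan (g * letter ι a) p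

/-- The subgraph spanned by the journey labeled by a given term and starting at `g`: in
`u v^𝔪 t` one traverses the path labeled by `u`, then jumps from the current vertex `h` to
`h v_G`, and continues with `t` from there. For `g = 1` this is `⟨w̄⟩`. -/
def journeySpan (g : G) : FTerm X → Subgr ι
  | .word a => pathSpan ι g a
  | .jump a b t => pathSpan ι g a ⊔ journeySpan (g * wordVal ι a * wordVal ι b) t

/-- The term `w` labels a journey from `g` to `h` in the subgraph `Δ`. -/
def Labels (Δ : Subgr ι) (t : FTerm X) (g h : G) : Prop :=
  journeySpan ι g t ≤ Δ ∧ g * t.groupVal ι = h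

variable {ι}

theorem Subgr.vert_le_iff {g : G} {Δ : Subgr ι} : Subgr.vert ι g ≤ Δ ↔ g ∈ Δ.verts :=
  ⟨fun h => h.1 rfl, fun h => ⟨fun _ k => by rw [k]; exact h, fun _ k => k.elim⟩⟩

theorem Subgr.vert_finite (g : G) : (Subgr.vert ι g).IsFinite :=
  ⟨Set.finite_singleton _, Set.finite_empty⟩

theorem Subgr.smul_vert (k g : G) : k • Subgr.vert ι g = Subgr.vert ι (k * g) := by
  refine Subgr.ext (Set.ext fun h => ?_) (Set.ext fun e => ?_)
  · change k⁻¹ * h = g ↔ h = k * g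
    exact inv_mul_eq_iff_eq_mul
  · exact Iff.rfl

theorem Subgr.edge_finite (e : Edge X G) : (Subgr.edge ι e).IsFinite :=
  ⟨Set.toFinite {e.1, Edge.tgt ι e}, Set.toFinite {e, Edge.rev ι e}⟩

theorem Subgr.smul_edge (k g : G) (a : X × Bool) :
    k • Subgr.edge ι (g, a) = Subgr.edge ι (k * g, a) := by
  refine Subgr.ext (Set.ext fun h => ?_) (Set.ext fun e => ?_)
  · change (k⁻¹ * h = g ∨ k⁻¹ * h = g * letter ι a) ↔ (h = k * g ∨ h = k * g * letter ι a)
    rw [inv_mul_eq_iff_eq_mul, inv_mul_eq_iff_eq_mul, mul_assoc]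
  · obtain ⟨h, b⟩ := e
    change ((k⁻¹ * h, b) = (g, a) ∨ (k⁻¹ * h, b) = (g * letter ι a, (a.1, !a.2))) ↔
      ((h, b) = (k * g, a) ∨ (h, b) = (k * g * letter ι a, (a.1, !a.2)))
    simp only [Prod.mk.injEq]
    rw [inv_mul_eq_iff_eq_mul, inv_mul_eq_iff_eq_mul, mul_assoc]

theorem smul_pathSpan (k : G) (p : Word X) :
    ∀ g : G, k • pathSpan ι g p = pathSpan ι (k * g) p := by
  induction p with
  | nil => exact fun g => Subgr.smul_vert k g
  | cons a p ih =>
    intro g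
    rw [pathSpan, pathSpan, Subgr.smul_sup, Subgr.smul_edge, ih, mul_assoc]

theorem smul_journeySpan (k : G) (t : FTerm X) :
    ∀ g : G, k • journeySpan ι g t = journeySpan ι (k * g) t := by
  induction t with
  | word a => exact fun g => smul_pathSpan k a g
  | jump a b t ih =>
    intro g
    rw [journeySpan, journeySpan, Subgr.smul_sup, smul_pathSpan, ih]
    simp only [mul_assoc]

theorem labels_smul {k g h : G} {Δ : Subgr ι} {t : FTerm X} :
    Labels ι (k • Δ) t g h ↔ Labels ι Δ t (k⁻¹ * g) (k⁻¹ * h) := by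
  unfold Labels
  rw [← smul_journeySpan, Subgr.smul_le_iff, inv_inv, mul_assoc, mul_right_inj]

end Subgraphs

/-! ### Closure operators -/

/-- `G`-invariant closure operators on the lattice of subgraphs of the Cayley graph. -/
structure InvClosure {X : Type u} {G : Type w} [Group G] (ι : X → G)
    extends ClosureOperator (Subgr ι) where
  smul_closure : ∀ (g : G) (Δ : Subgr ι), toFun (g • Δ) = g • toFun Δ

section Closure

variable {X : Type u} {G : Type w} [Group G] {ι : X → G}

instance : CoeFun (InvClosure ι) (fun _ => Subgr ι → Subgr ι) where
  coe c := c.toClosureOperator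

theorem InvClosure.map_smul (c : InvClosure ι) (g : G) (Δ : Subgr ι) : c (g • Δ) = g • c Δ :=
  c.smul_closure g Δ

/-- Finitary closure operators: `Δ^c` is the union of all `F^c` with `F ⊆ Δ` finite. -/
def InvClosure.Finitary (c : InvClosure ι) : Prop :=
  ∀ Δ : Subgr ι, c Δ = sSup {E | ∃ F : Subgr ι, F ≤ Δ ∧ F.IsFinite ∧ E = c F}

/-- Compact subgraphs: closures of finite subgraphs. -/
def InvClosure.IsCompact (c : InvClosure ι) (Δ : Subgr ι) : Prop :=
  ∃ F : Subgr ι, F.IsFinite ∧ Δ = c F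

theorem InvClosure.IsCompact.closure_eq {c : InvClosure ι} {Δ : Subgr ι} (h : c.IsCompact Δ) :
    c Δ = Δ := by
  obtain ⟨F, -, rfl⟩ := h
  exact c.idempotent F

theorem InvClosure.IsCompact.smul {c : InvClosure ι} {Δ : Subgr ι} (h : c.IsCompact Δ) (g : G) :
    c.IsCompact (g • Δ) := by
  obtain ⟨F, hF, rfl⟩ := h
  exact ⟨g • F, hF.smul g, (c.map_smul g F).symm⟩

theorem InvClosure.IsCompact.mul {c : InvClosure ι} {Δ Ξ : Subgr ι} (h : c.IsCompact Δ)
    (k : c.IsCompact Ξ) (g : G) : c.IsCompact (c (Δ ⊔ g • Ξ)) := by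
  obtain ⟨F, hF, rfl⟩ := h
  obtain ⟨E, hE, rfl⟩ := k
  refine ⟨F ⊔ g • E, hF.sup (hE.smul g), ?_⟩
  rw [← c.map_smul]
  exact c.closure_sup_closure _ _

/-- For a relation `R` on terms, the subgraph `Δ` is closed if for all `(t, t') ∈ R` and all
vertices `g`, `h` of `Δ`, `t` labels a journey from `g` to `h` in `Δ` if and only if `t'` does. -/
def RelClosed (R : FTerm X → FTerm X → Prop) (Δ : Subgr ι) : Prop :=
  ∀ t t' : FTerm X, R t t' → ∀ g ∈ Δ.verts, ∀ h ∈ Δ.verts, Labels ι Δ t g h ↔ Labels ι Δ t' g h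

theorem pathSpan_start_mem (g : G) (p : Word X) : g ∈ (pathSpan ι g p).verts := by
  cases p with
  | nil => exact rfl
  | cons a p => exact Or.inl (Or.inl rfl)

theorem journeySpan_start_mem (g : G) (t : FTerm X) : g ∈ (journeySpan ι g t).verts := by
  cases t with
  | word a => exact pathSpan_start_mem g a
  | jump a b t => exact Or.inl (pathSpan_start_mem g a)

theorem pathSpan_finish_mem (p : Word X) :
    ∀ g : G, g * wordVal ι p ∈ (pathSpan ι g p).verts := by
  induction p with
  | nil => exact fun g => mul_one g
  | cons a p ih =>
    intro g
    rw [wordVal, ← mul_assoc]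
    exact Or.inr (ih _)

theorem journeySpan_finish_mem (t : FTerm X) :
    ∀ g : G, g * t.groupVal ι ∈ (journeySpan ι g t).verts := by
  induction t with
  | word a => exact pathSpan_finish_mem a
  | jump a b t ih =>
    intro g
    have := ih (g * wordVal ι a * wordVal ι b)
    rw [FTerm.groupVal]
    refine Or.inr ?_
    simpa only [mul_assoc] using this

theorem pathSpan_finite (p : Word X) : ∀ g : G, (pathSpan ι g p).IsFinite := by
  induction p with
  | nil => exact fun g => Subgr.vert_finite g
  | cons a p ih => exact fun g => (Subgr.edge_finite _).sup (ih _)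

theorem relClosed_sInf {R : FTerm X → FTerm X → Prop}
    (hR : ∀ t t', R t t' → t.groupVal ι = t'.groupVal ι) (A : Set (Subgr ι))
    (hA : ∀ Δ ∈ A, RelClosed R Δ) : RelClosed R (sInf A) := by
  intro t t' htt g hg h hh
  have key : ∀ s, Labels ι (sInf A) s g h ↔ (g * s.groupVal ι = h ∧ ∀ Δ ∈ A, Labels ι Δ s g h) := by
    intro s
    unfold Labels
    rw [le_sInf_iff]
    exact ⟨fun H => ⟨H.2, fun Δ hΔ => ⟨H.1 Δ hΔ, H.2⟩⟩, fun H => ⟨fun Δ hΔ => (H.2 Δ hΔ).1, H.1⟩⟩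
  rw [key, key, hR t t' htt]
  exact and_congr_right fun _ => forall₂_congr fun Δ hΔ => hA Δ hΔ t t' htt g (hg Δ hΔ) h (hh Δ hΔ)

theorem RelClosed.smul {R : FTerm X → FTerm X → Prop} {Δ : Subgr ι} (hΔ : RelClosed R Δ) (k : G) :
    RelClosed R (k • Δ) := by
  intro t t' htt g hg h hh
  rw [labels_smul, labels_smul]
  exact hΔ t t' htt _ hg _ hh

/-- The `G`-invariant closure operator whose closed subgraphs are those defined by the
relation `R`, any two `R`-related terms being equal in `G`: the closure of `Δ` is the intersection
of all closed subgraphs that contain `Δ`. -/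
def relClosure (R : FTerm X → FTerm X → Prop)
    (hR : ∀ t t', R t t' → t.groupVal ι = t'.groupVal ι) : InvClosure ι where
  toClosureOperator := ClosureOperator.ofCompletePred (RelClosed R) (relClosed_sInf hR)
  smul_closure := by
    set c : ClosureOperator (Subgr ι) :=
      ClosureOperator.ofCompletePred (RelClosed R) (relClosed_sInf hR) with hc
    have hle : ∀ (g : G) (Δ : Subgr ι), c (g • Δ) ≤ g • c Δ := fun g Δ =>
      c.closure_min (Subgr.smul_mono g (c.le_closure Δ))
        (RelClosed.smul (c.isClosed_closure Δ : RelClosed R (c Δ)) g)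
    intro g Δ
    refine le_antisymm (hle g Δ) ?_
    have := hle g⁻¹ (g • Δ)
    rw [inv_smul_smul] at this
    exact Subgr.smul_le_iff.2 this

end Closure

/-! ### The closure operator of an `F`-inverse monoid -/

section ClosureOfMonoid

variable {X : Type u} {S : Type v} [FInverseMonoid S] {G : Type w} [Group G]

theorem map_inv' (π : S →* G) (a : S) : π a⁻¹ = (π a)⁻¹ := by
  have h := congrArg π (InverseMonoid.mul_inv_mul a)
  rw [map_mul, map_mul, mul_assoc, mul_eq_left] at h
  exact eq_inv_of_mul_eq_one_left h

theorem map_natLE (π : S →* G) {a b : S} (h : NatLE a b) : π a = π b := by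
  have h' := congrArg π h
  simpa [map_inv'] using h'

theorem map_mx (π : S →* G) (a : S) : π (FInverseMonoid.mx a) = π a := by
  obtain ⟨r, h, k⟩ := FInverseMonoid.sigma_mx a
  rw [← map_natLE π h, ← map_natLE π k]

theorem map_wordVal {ιS : X → S} {ιG : X → G} (π : S →* G) (hπ : ∀ x, π (ιS x) = ιG x)
    (p : Word X) : π (wordVal ιS p) = wordVal ιG p := by
  induction p with
  | nil => exact map_one π
  | cons a p ih =>
    rw [wordVal, wordVal, map_mul, ih]
    obtain ⟨x, b⟩ := a
    cases b <;> simp [letter, map_inv', hπ]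

theorem map_val {ιS : X → S} {ιG : X → G} (π : S →* G) (hπ : ∀ x, π (ιS x) = ιG x)
    (t : FTerm X) : π (t.val ιS) = t.groupVal ιG := by
  induction t with
  | word a => exact map_wordVal π hπ a
  | jump a b t ih =>
    rw [FTerm.val, FTerm.groupVal, map_mul, map_mul, ih, map_mx, map_wordVal π hπ,
      map_wordVal π hπ]

/-- The closure operator `c_S` on the subgraphs of the Cayley graph of `G`, associated to the
`F`-inverse monoid `S` with generators `ιS` and canonical homomorphism `π` onto `G`: it comes from
the relation consisting of all pairs of terms with the same value in `S`. -/
def closureOf (ιS : X → S) (ιG : X → G) (π : S →* G) (hπ : ∀ x, π (ιS x) = ιG x) :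
    InvClosure ιG :=
  relClosure (fun t t' => t.val ιS = t'.val ιS) fun t t' h => by
    rw [← map_val π hπ, ← map_val π hπ, h]

/-- The `F`-Schützenberger graph `FΓ(w) = ⟨w̄⟩^{c_S}` of a term `w`. -/
def FSchTerm (ιS : X → S) (ιG : X → G) (π : S →* G) (hπ : ∀ x, π (ιS x) = ιG x) (t : FTerm X) :
    Subgr ιG :=
  closureOf ιS ιG π hπ (journeySpan ιG 1 t)

open Classical in
/-- The `F`-Schützenberger graph `FΓ(s)` of an element `s`: it is `FΓ(w)` for some term `w`
with `w_S = s` (such a `w` exists if `S` is generated by `ιS`). -/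
noncomputable def FSch (ιS : X → S) (ιG : X → G) (π : S →* G) (hπ : ∀ x, π (ιS x) = ιG x)
    (s : S) : Subgr ιG :=
  if h : ∃ t : FTerm X, t.val ιS = s then FSchTerm ιS ιG π hπ h.choose else ⊥

end ClosureOfMonoid

/-! ### The `F`-inverse monoid of a closure operator -/

/-- The set `S_c` of pairs `(Δ, g)`, where `Δ` is a compact subgraph containing `1` and `g`. -/
@[ext]
structure ClosureMonoid {X : Type u} {G : Type w} [Group G] {ι : X → G} (c : InvClosure ι) where
  graph : Subgr ι
  elt : G
  compact : c.IsCompact graph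
  one_mem : 1 ∈ graph.verts
  elt_mem : elt ∈ graph.verts

namespace ClosureMonoid

variable {X : Type u} {G : Type w} [Group G] {ι : X → G} {c : InvClosure ι}

theorem closure_graph (a : ClosureMonoid c) : c a.graph = a.graph := a.compact.closure_eq

/-- `(Δ, g)(Ξ, h) = ((Δ ∪ gΞ)^c, gh)`. -/
instance : Mul (ClosureMonoid c) where
  mul a b :=
    { graph := c (a.graph ⊔ a.elt • b.graph)
      elt := a.elt * b.elt
      compact := a.compact.mul b.compact a.elt
      one_mem := (c.le_closure _).1 (Or.inl a.one_mem)
      elt_mem := (c.le_closure _).1 (Or.inr (by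
        rw [Subgr.mem_verts_smul, inv_mul_cancel_left]
        exact b.elt_mem)) }

/-- `(Δ, g)⁻¹ = (g⁻¹Δ, g⁻¹)`. -/
instance : Inv (ClosureMonoid c) where
  inv a :=
    { graph := a.elt⁻¹ • a.graph
      elt := a.elt⁻¹
      compact := a.compact.smul _
      one_mem := by
        rw [Subgr.mem_verts_smul, inv_inv, mul_one]
        exact a.elt_mem
      elt_mem := by
        rw [Subgr.mem_verts_smul, inv_inv, mul_inv_cancel]
        exact a.one_mem }

/-- The identity element `({1}^c, 1)`. -/
instance : One (ClosureMonoid c) where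
  one :=
    { graph := c (Subgr.vert ι 1)
      elt := 1
      compact := ⟨_, Subgr.vert_finite 1, rfl⟩
      one_mem := (c.le_closure _).1 rfl
      elt_mem := (c.le_closure _).1 rfl }

theorem graph_mul (a b : ClosureMonoid c) : (a * b).graph = c (a.graph ⊔ a.elt • b.graph) := rfl

theorem elt_mul (a b : ClosureMonoid c) : (a * b).elt = a.elt * b.elt := rfl

theorem graph_inv (a : ClosureMonoid c) : (a⁻¹).graph = a.elt⁻¹ • a.graph := rfl

theorem elt_inv (a : ClosureMonoid c) : (a⁻¹).elt = a.elt⁻¹ := rfl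

theorem graph_one : (1 : ClosureMonoid c).graph = c (Subgr.vert ι 1) := rfl

theorem elt_one : (1 : ClosureMonoid c).elt = 1 := rfl

instance : Monoid (ClosureMonoid c) where
  mul_assoc a b d := by
    refine ClosureMonoid.ext ?_ (mul_assoc _ _ _)
    simp only [graph_mul, elt_mul]
    rw [c.closure_sup_closure_left, ← c.map_smul, c.closure_sup_closure_right, Subgr.smul_sup,
      mul_smul, sup_assoc]
  one_mul a := by
    refine ClosureMonoid.ext ?_ (one_mul _)
    rw [graph_mul, graph_one, elt_one, one_smul, c.closure_sup_closure_left,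
      sup_eq_right.2 (Subgr.vert_le_iff.2 a.one_mem), closure_graph]
  mul_one a := by
    refine ClosureMonoid.ext ?_ (mul_one _)
    rw [graph_mul, graph_one, ← c.map_smul, c.closure_sup_closure_right, Subgr.smul_vert, mul_one,
      sup_eq_left.2 (Subgr.vert_le_iff.2 a.elt_mem), closure_graph]

theorem graph_mul_inv (a : ClosureMonoid c) : (a * a⁻¹).graph = a.graph := by
  rw [graph_mul, graph_inv, smul_inv_smul, sup_idem, closure_graph]

theorem elt_mul_inv (a : ClosureMonoid c) : (a * a⁻¹).elt = 1 := mul_inv_cancel _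

instance : InverseMonoid (ClosureMonoid c) where
  mul_inv_mul a := by
    refine ClosureMonoid.ext ?_ (by simp [elt_mul, elt_inv])
    rw [graph_mul, graph_mul_inv, elt_mul_inv, one_smul, sup_idem, closure_graph]
  inv_mul_inv a := by
    refine ClosureMonoid.ext ?_ ?_
    · rw [graph_mul, graph_mul, graph_inv, elt_mul, elt_inv, c.closure_sup_closure_left,
        inv_mul_cancel, one_smul, sup_idem, sup_idem, c.map_smul, closure_graph]
    · simp [elt_mul, elt_inv]
  inv_unique a b h k := by
    have he : b.elt = a.elt⁻¹ := by
      have := congrArg elt h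
      rw [elt_mul, elt_mul, mul_assoc, mul_eq_left] at this
      exact eq_inv_of_mul_eq_one_left this
    refine ClosureMonoid.ext (le_antisymm ?_ ?_) he
    · have h' := congrArg graph h
      rw [mul_assoc, graph_mul] at h'
      rw [graph_inv, ← Subgr.smul_le_iff, ← h', graph_mul]
      refine le_trans (Subgr.smul_mono _ ?_) (le_sup_right.trans (c.le_closure _))
      exact le_sup_left.trans (c.le_closure _)
    · have k' := congrArg graph k
      rw [mul_assoc, graph_mul] at k'
      rw [graph_inv, ← he, ← k', graph_mul]
      refine le_trans (Subgr.smul_mono _ ?_) (le_sup_right.trans (c.le_closure _))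
      exact le_sup_left.trans (c.le_closure _)

theorem natLE_iff {a b : ClosureMonoid c} : NatLE a b ↔ a.elt = b.elt ∧ b.graph ≤ a.graph := by
  unfold NatLE
  constructor
  · intro h
    have h1 := congrArg elt h
    rw [elt_mul, elt_mul_inv, one_mul] at h1
    have h2 := congrArg graph h
    rw [graph_mul, graph_mul_inv, elt_mul_inv, one_smul] at h2
    refine ⟨h1, ?_⟩
    rw [h2]
    exact le_sup_right.trans (c.le_closure _)
  · rintro ⟨h1, h2⟩
    refine ClosureMonoid.ext ?_ ?_
    · rw [graph_mul, graph_mul_inv, elt_mul_inv, one_smul, sup_eq_left.2 h2, closure_graph]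
    · rw [elt_mul, elt_mul_inv, one_mul, h1]

/-- The element `({1, g}^c, g)`. -/
def top (c : InvClosure ι) (g : G) : ClosureMonoid c where
  graph := c (Subgr.vert ι 1 ⊔ Subgr.vert ι g)
  elt := g
  compact := ⟨_, (Subgr.vert_finite 1).sup (Subgr.vert_finite g), rfl⟩
  one_mem := (c.le_closure _).1 (Or.inl rfl)
  elt_mem := (c.le_closure _).1 (Or.inr rfl)

theorem le_top (a : ClosureMonoid c) : NatLE a (top c a.elt) := by
  refine natLE_iff.2 ⟨rfl, ?_⟩
  rw [← a.closure_graph]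
  exact c.monotone (sup_le (Subgr.vert_le_iff.2 a.one_mem) (Subgr.vert_le_iff.2 a.elt_mem))

theorem elt_eq_of_sigma {a b : ClosureMonoid c} (h : SigmaRel a b) : a.elt = b.elt := by
  obtain ⟨r, h, k⟩ := h
  rw [← (natLE_iff.1 h).1, (natLE_iff.1 k).1]

/-- `S_c` is an `F`-inverse monoid with `(Δ, g)^𝔪 = ({1, g}^c, g)`. -/
instance : FInverseMonoid (ClosureMonoid c) where
  mx a := top c a.elt
  sigma_mx a := ⟨a, natLE_iff.2 ⟨rfl, le_rfl⟩, le_top a⟩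
  le_mx a b h := by
    rw [elt_eq_of_sigma h]
    exact le_top b

/-- The generators `x ↦ (⟨x̄⟩^c, x_G)` of `S_c`. -/
def gen (c : InvClosure ι) (x : X) : ClosureMonoid c where
  graph := c (pathSpan ι 1 [(x, true)])
  elt := ι x
  compact := ⟨_, pathSpan_finite _ _, rfl⟩
  one_mem := (c.le_closure _).1 (pathSpan_start_mem _ _)
  elt_mem := (c.le_closure _).1 (by
    have := pathSpan_finish_mem (ι := ι) [(x, true)] 1
    simpa [wordVal, letter] using this)

/-- The projection `(Δ, g) ↦ g` of `S_c` onto `G`. -/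
def proj (c : InvClosure ι) : ClosureMonoid c →* G where
  toFun := elt
  map_one' := rfl
  map_mul' _ _ := rfl

/-- The closure operator `c_{S_c}` of the `F`-inverse monoid `S_c`. -/
def closure (c : InvClosure ι) : InvClosure ι :=
  closureOf (gen c) ι (proj c) fun _ => rfl

end ClosureMonoid

end FInv

open FInv

/-!
A term `w` has the value `(⟨w̄⟩^c, w_G)` in `S_c`. For `c = c_S` this makes `ψ` the map that sends
the value of `w` in `S` to its value in `S_c`, and all that has to be shown is that terms with the
same image in `G` and the same closure have the same value in `S`. In an `F`-inverse monoid,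
`𝓡`-related elements with the same image in `G` are equal, so the Schützenberger graph of `s` (the
strong component of `s` in the right Cayley graph of `S`) embeds in the Cayley graph of `G`, and
there, also in the presence of jumps, a term `t` labels a journey from `x` if and only if
`x t_S 𝓡 s`. Hence the Schützenberger graph of `w_S` is `c_S`-closed and contains `⟨w̄⟩^{c_S}`,
which makes `⟨w̄'⟩ ⊆ ⟨w̄⟩^{c_S}` force `w_S ≤ w'_S`.

Conversely, if `c` is given and `F` is a finite subgraph containing `1`, then jumps allow one to
span `F` by a journey from `1` to `1`. For finite `E ⊆ F^c` the terms obtained in this way from `F`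
and `F ∪ E` have the same value in `S_c`, so that `E` is contained in the `c_{S_c}`-closure of `F`;
finitarity extends this to all non-empty subgraphs.
-/

namespace FInv

/-! ### Inverse monoids -/

namespace InverseMonoid

variable {S : Type v} [InverseMonoid S] {a b e f : S}

theorem inv_eq_self (he : IsIdempotentElem e) : e⁻¹ = e :=
  (inv_unique e e (by rw [he.eq, he.eq]) (by rw [he.eq, he.eq])).symm

protected theorem inv_inv (a : S) : a⁻¹⁻¹ = a :=
  (inv_unique a⁻¹ a (inv_mul_inv a) (mul_inv_mul a)).symm

protected theorem inv_one : (1 : S)⁻¹ = 1 :=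
  inv_eq_self (one_mul 1)

theorem isIdempotentElem_mul_inv (a : S) : IsIdempotentElem (a * a⁻¹) := by
  rw [IsIdempotentElem, ← mul_assoc, mul_inv_mul]

theorem isIdempotentElem_inv_mul (a : S) : IsIdempotentElem (a⁻¹ * a) := by
  rw [IsIdempotentElem, ← mul_assoc, inv_mul_inv]

theorem isIdempotentElem_mul (he : IsIdempotentElem e) (hf : IsIdempotentElem f) :
    IsIdempotentElem (e * f) := by
  have hmul := mul_inv_mul (e * f)
  have hinv := inv_mul_inv (e * f)
  set x := (e * f)⁻¹ with hx
  -- `f x e` is an inverse of `e f` as well, and `f x e = x` makes `x` idempotent.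
  have hfxe : f * x * e = x := by
    refine inv_unique (e * f) (f * x * e) ?_ ?_
    · calc e * f * (f * x * e) * (e * f) = e * (f * f) * x * ((e * e) * f) := by
            simp only [mul_assoc]
        _ = e * f := by rw [he.eq, hf.eq, hmul]
    · calc f * x * e * (e * f) * (f * x * e) = f * (x * ((e * e) * (f * f)) * x) * e := by
            simp only [mul_assoc]
        _ = f * x * e := by rw [he.eq, hf.eq, hinv]
  have hxx : IsIdempotentElem x :=
    calc x * x = (f * x * e) * (f * x * e) := by rw [hfxe]
      _ = f * (x * (e * f) * x) * e := by simp only [mul_assoc]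
      _ = x := by rw [hinv, hfxe]
  rwa [← InverseMonoid.inv_inv (e * f), ← hx, inv_eq_self hxx]

theorem commute_of_isIdempotentElem (he : IsIdempotentElem e) (hf : IsIdempotentElem f) :
    Commute e f := by
  have hef := isIdempotentElem_mul he hf
  have hfe := isIdempotentElem_mul hf he
  have hinv : f * e = (e * f)⁻¹ := by
    refine inv_unique (e * f) (f * e) ?_ ?_
    · calc e * f * (f * e) * (e * f) = e * (f * f) * ((e * e) * f) := by simp only [mul_assoc]
        _ = e * f := by rw [he.eq, hf.eq, hef.eq]
    · calc f * e * (e * f) * (f * e) = f * (e * e) * ((f * f) * e) := by simp only [mul_assoc]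
        _ = f * e := by rw [he.eq, hf.eq, hfe.eq]
  rw [Commute, SemiconjBy, hinv, inv_eq_self hef]

protected theorem mul_inv_rev (a b : S) : (a * b)⁻¹ = b⁻¹ * a⁻¹ := by
  have hcomm := (commute_of_isIdempotentElem (isIdempotentElem_mul_inv b)
    (isIdempotentElem_inv_mul a)).eq
  refine (inv_unique (a * b) (b⁻¹ * a⁻¹) ?_ ?_).symm
  · calc a * b * (b⁻¹ * a⁻¹) * (a * b) = a * (b * b⁻¹ * (a⁻¹ * a)) * b := by
          simp only [mul_assoc]
      _ = a * a⁻¹ * a * (b * b⁻¹ * b) := by rw [hcomm]; simp only [mul_assoc]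
      _ = a * b := by rw [mul_inv_mul, mul_inv_mul]
  · calc b⁻¹ * a⁻¹ * (a * b) * (b⁻¹ * a⁻¹) = b⁻¹ * (a⁻¹ * a * (b * b⁻¹)) * a⁻¹ := by
          simp only [mul_assoc]
      _ = b⁻¹ * b * b⁻¹ * (a⁻¹ * a * a⁻¹) := by rw [← hcomm]; simp only [mul_assoc]
      _ = b⁻¹ * a⁻¹ := by rw [inv_mul_inv, inv_mul_inv]

theorem isIdempotentElem_conj (he : IsIdempotentElem e) (a : S) :
    IsIdempotentElem (a * e * a⁻¹) := by
  have hcomm := (commute_of_isIdempotentElem (isIdempotentElem_inv_mul a) he).eq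
  calc a * e * a⁻¹ * (a * e * a⁻¹) = a * (e * (a⁻¹ * a * e)) * a⁻¹ := by simp only [mul_assoc]
    _ = a * (e * e) * (a⁻¹ * a * a⁻¹) := by rw [hcomm]; simp only [mul_assoc]
    _ = a * e * a⁻¹ := by rw [he.eq, inv_mul_inv]

theorem natLE_iff_exists_isIdempotentElem_mul :
    NatLE a b ↔ ∃ e, IsIdempotentElem e ∧ a = e * b := by
  refine ⟨fun h => ⟨a * a⁻¹, isIdempotentElem_mul_inv a, h⟩, ?_⟩
  rintro ⟨e, he, rfl⟩
  have hcomm := (commute_of_isIdempotentElem he (isIdempotentElem_mul_inv b)).eq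
  refine Eq.symm ?_
  calc e * b * (e * b)⁻¹ * b = e * (b * b⁻¹ * e) * b := by
        rw [InverseMonoid.mul_inv_rev, inv_eq_self he]; simp only [mul_assoc]
    _ = e * e * (b * b⁻¹ * b) := by rw [← hcomm]; simp only [mul_assoc]
    _ = e * b := by rw [he.eq, mul_inv_mul]

theorem natLE_iff_exists_mul_isIdempotentElem :
    NatLE a b ↔ ∃ e, IsIdempotentElem e ∧ a = b * e := by
  rw [natLE_iff_exists_isIdempotentElem_mul]
  constructor <;> rintro ⟨e, he, rfl⟩
  · have hcomm := (commute_of_isIdempotentElem he (isIdempotentElem_mul_inv b)).eq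
    have hconj := isIdempotentElem_conj he b⁻¹
    rw [InverseMonoid.inv_inv] at hconj
    refine ⟨b⁻¹ * e * b, hconj, ?_⟩
    calc e * b = e * (b * b⁻¹) * b := by rw [mul_assoc, mul_inv_mul]
      _ = b * (b⁻¹ * e * b) := by rw [hcomm]; simp only [mul_assoc]
  · have hcomm := (commute_of_isIdempotentElem he (isIdempotentElem_inv_mul b)).eq
    refine ⟨b * e * b⁻¹, isIdempotentElem_conj he b, ?_⟩
    calc b * e = b * (b⁻¹ * b * e) := by rw [← mul_assoc, ← mul_assoc, mul_inv_mul]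
      _ = b * e * b⁻¹ * b := by rw [← hcomm]; simp only [mul_assoc]

protected theorem map_inv {T F : Type*} [InverseMonoid T] [FunLike F S T] [MulHomClass F S T]
    (φ : F) (a : S) : φ a⁻¹ = (φ a)⁻¹ := by
  refine inv_unique _ _ ?_ ?_
  · rw [← map_mul, ← map_mul, mul_inv_mul]
  · rw [← map_mul, ← map_mul, inv_mul_inv]

end InverseMonoid

section NaturalOrder

variable {S : Type v} [InverseMonoid S] {a b : S}

theorem NatLE.refl (a : S) : NatLE a a :=
  (InverseMonoid.mul_inv_mul a).symm

theorem NatLE.antisymm (hab : NatLE a b) (hba : NatLE b a) : a = b := by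
  have hcomm := (InverseMonoid.commute_of_isIdempotentElem
    (InverseMonoid.isIdempotentElem_mul_inv a) (InverseMonoid.isIdempotentElem_mul_inv b)).eq
  unfold NatLE at hab hba
  calc a = a * a⁻¹ * b := hab
    _ = a * a⁻¹ * (b * b⁻¹) * a := by rw [mul_assoc _ _ a, ← hba]
    _ = b * b⁻¹ * (a * a⁻¹ * a) := by rw [hcomm, mul_assoc]
    _ = b := by rw [InverseMonoid.mul_inv_mul, ← hba]

theorem NatLE.inv (h : NatLE a b) : NatLE a⁻¹ b⁻¹ := by
  obtain ⟨e, he, rfl⟩ := InverseMonoid.natLE_iff_exists_isIdempotentElem_mul.1 h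
  rw [InverseMonoid.mul_inv_rev, InverseMonoid.inv_eq_self he]
  exact InverseMonoid.natLE_iff_exists_mul_isIdempotentElem.2 ⟨e, he, rfl⟩

theorem SigmaRel.refl (a : S) : SigmaRel a a :=
  ⟨a, .refl a, .refl a⟩

theorem SigmaRel.symm (h : SigmaRel a b) : SigmaRel b a :=
  h.imp fun _ => And.symm

theorem SigmaRel.inv (h : SigmaRel a b) : SigmaRel a⁻¹ b⁻¹ :=
  h.elim fun _ hr => ⟨_, hr.1.inv, hr.2.inv⟩

variable {T F : Type*} [InverseMonoid T] [FunLike F S T] [MulHomClass F S T]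

theorem NatLE.map (φ : F) (h : NatLE a b) : NatLE (φ a) (φ b) := by
  have := congrArg φ h
  rwa [map_mul, map_mul, InverseMonoid.map_inv] at this

theorem SigmaRel.map (φ : F) (h : SigmaRel a b) : SigmaRel (φ a) (φ b) :=
  h.elim fun _ hr => ⟨_, hr.1.map φ, hr.2.map φ⟩

end NaturalOrder

/-! ### `F`-inverse monoids and Green's relation `𝓡` -/

namespace FInverseMonoid

variable {S : Type v} [FInverseMonoid S] {s t : S}

theorem le_mx_self (s : S) : NatLE s (mx s) :=
  le_mx s s (.refl s)

theorem mx_eq_of_sigmaRel (h : SigmaRel s t) : mx s = mx t := by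
  have mx_le_mx {s t : S} (h : SigmaRel s t) : NatLE (mx s) (mx t) :=
    le_mx t (mx s) ⟨t, .refl t, le_mx s t h⟩
  exact (mx_le_mx h).antisymm (mx_le_mx h.symm)

theorem mx_inv (s : S) : mx s⁻¹ = (mx s)⁻¹ := by
  have inv_mx_le (s : S) : NatLE (mx s)⁻¹ (mx s⁻¹) := le_mx _ _ (sigma_mx s).inv
  refine NatLE.antisymm ?_ (inv_mx_le s)
  simpa only [InverseMonoid.inv_inv] using (inv_mx_le s⁻¹).inv

protected theorem map_mx {T : Type*} [FInverseMonoid T] (φ : S ≃* T) (s : S) :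
    φ (mx s) = mx (φ s) := by
  refine NatLE.antisymm (le_mx _ _ ((sigma_mx s).map φ)) ?_
  have h : SigmaRel s (φ.symm (mx (φ s))) := by
    simpa only [MulEquiv.symm_apply_apply] using (sigma_mx (φ s)).map φ.symm
  simpa only [MulEquiv.apply_symm_apply] using (le_mx _ _ h).map φ

end FInverseMonoid

/-- Green's relation `𝓡`: the elements `a` and `b` generate the same principal right ideal.
Divisibility in a noncommutative monoid means divisibility on the left. -/
def GreenR {M : Type v} [Monoid M] (a b : M) : Prop := a ∣ b ∧ b ∣ a

namespace GreenR

section Monoid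

variable {M : Type v} [Monoid M] {a b c : M}

theorem symm (h : GreenR a b) : GreenR b a :=
  And.symm h

theorem trans (hab : GreenR a b) (hbc : GreenR b c) : GreenR a c :=
  ⟨hab.1.trans hbc.1, hbc.2.trans hab.2⟩

theorem mul_of_mul_mul {x y z : M} (hx : GreenR a x) (hxyz : GreenR a (x * y * z)) :
    GreenR a (x * y) :=
  ⟨hx.1.mul_right y, (dvd_mul_right _ z).trans hxyz.2⟩

end Monoid

section InverseMonoid

variable {S : Type v} [InverseMonoid S] {a b : S}

theorem self_mul_inv (a : S) : GreenR a (a * a⁻¹) :=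
  ⟨dvd_mul_right a a⁻¹, a, (InverseMonoid.mul_inv_mul a).symm⟩

theorem mul_inv_mul (h : GreenR a b) : a * a⁻¹ * b = b := by
  obtain ⟨c, rfl⟩ := h.1
  rw [← mul_assoc, InverseMonoid.mul_inv_mul]

theorem mul_inv_eq (h : GreenR a b) : a * a⁻¹ = b * b⁻¹ := by
  have hcomm := (InverseMonoid.commute_of_isIdempotentElem
    (InverseMonoid.isIdempotentElem_mul_inv a) (InverseMonoid.isIdempotentElem_mul_inv b)).eq
  rw [← mul_assoc, h.mul_inv_mul, ← mul_assoc, h.symm.mul_inv_mul] at hcomm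
  exact hcomm.symm

theorem mul_mul_inv {s x y : S} (hx : GreenR s x) (hxy : GreenR s (x * y)) :
    GreenR s (x * y * y⁻¹) := by
  rw [mul_assoc]
  refine hx.mul_of_mul_mul (z := y) ?_
  rwa [mul_assoc, InverseMonoid.mul_inv_mul]

end InverseMonoid

variable {S : Type v} [FInverseMonoid S] {x y : S}

theorem eq_of_sigmaRel (h : GreenR x y) (hσ : SigmaRel x y) : x = y :=
  calc x = x * x⁻¹ * FInverseMonoid.mx x := FInverseMonoid.le_mx_self x
    _ = y * y⁻¹ * FInverseMonoid.mx y := by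
      rw [h.mul_inv_eq, FInverseMonoid.mx_eq_of_sigmaRel hσ]
    _ = y := (FInverseMonoid.le_mx_self y).symm

variable {G : Type w} [Group G] {π : S →* G}

theorem mul_mx_eq (hG : IsGreatestGroupImage π) {m : S} (h : GreenR x y) (hm : π y = π x * π m) :
    x * FInverseMonoid.mx m = y := by
  have hle : NatLE (x⁻¹ * y) (FInverseMonoid.mx m) :=
    FInverseMonoid.le_mx _ _ ((hG.2 _ _).1 (by rw [map_mul, map_inv', hm, inv_mul_cancel_left]))
  obtain ⟨f, -, hf⟩ := InverseMonoid.natLE_iff_exists_mul_isIdempotentElem.1 hle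
  have hdvd : x * FInverseMonoid.mx m ∣ y :=
    ⟨f, by rw [mul_assoc, ← hf, ← mul_assoc, h.mul_inv_mul]⟩
  refine eq_of_sigmaRel ⟨hdvd, h.2.mul_right _⟩ ((hG.2 _ _).1 ?_)
  rw [map_mul, map_mx, hm]

end GreenR

/-! ### Terms -/

section Terms

variable {X : Type u}

theorem wordVal_singleton {M : Type v} [Monoid M] [Inv M] (ι : X → M) (a : X × Bool) :
    wordVal ι [a] = letter ι a :=
  mul_one _

theorem wordVal_append {M : Type v} [Monoid M] [Inv M] (ι : X → M) (p q : Word X) :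
    wordVal ι (p ++ q) = wordVal ι p * wordVal ι q := by
  induction p with
  | nil => exact (one_mul _).symm
  | cons a p ih => rw [List.cons_append, wordVal, wordVal, ih, mul_assoc]

theorem InverseMonoid.letter_not {S : Type v} [InverseMonoid S] (ι : X → S) (a : X × Bool) :
    letter ι (a.1, !a.2) = (letter ι a)⁻¹ := by
  obtain ⟨x, b⟩ := a
  cases b <;> simp [letter, InverseMonoid.inv_inv]

theorem wordVal_invRev {S : Type v} [InverseMonoid S] (ι : X → S) (p : Word X) :
    wordVal ι (FreeGroup.invRev p) = (wordVal ι p)⁻¹ := by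
  induction p with
  | nil => exact InverseMonoid.inv_one.symm
  | cons a p ih =>
    rw [FreeGroup.invRev_cons, wordVal_append, ih, wordVal, InverseMonoid.mul_inv_rev,
      ← InverseMonoid.letter_not, ← wordVal_singleton]
    rfl

theorem wordVal_eq_lift {G : Type w} [Group G] (ι : X → G) (p : Word X) :
    wordVal ι p = FreeGroup.lift ι (FreeGroup.mk p) := by
  induction p with
  | nil => rfl
  | cons a p ih => simp [wordVal, letter, ih, Bool.cond_eq_ite]

theorem exists_wordVal_eq {G : Type w} [Group G] {ι : X → G}
    (hι : Subgroup.closure (Set.range ι) = ⊤) (g : G) : ∃ p : Word X, wordVal ι p = g := by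
  obtain ⟨⟨p⟩, rfl⟩ := FreeGroup.lift_surjective_iff_closure_range_eq_top.2 hι g
  exact ⟨p, wordVal_eq_lift ι p⟩

namespace FTerm

/-- Concatenation of terms, representing their product. -/
def append : FTerm X → FTerm X → FTerm X
  | .word a, .word b => .word (a ++ b)
  | .word a, .jump u v t => .jump (a ++ u) v t
  | .jump u v t, s => .jump u v (t.append s)

/-- The formal inverse of a term, with `(v^𝔪)⁻¹` written as `(v⁻¹)^𝔪`. -/
def inv : FTerm X → FTerm X
  | .word a => .word (FreeGroup.invRev a)
  | .jump a b t =>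
    t.inv.append (.jump [] (FreeGroup.invRev b) (.word (FreeGroup.invRev a)))

theorem val_append {S : Type v} [FInverseMonoid S] (ι : X → S) (t s : FTerm X) :
    (t.append s).val ι = t.val ι * s.val ι := by
  induction t with
  | word a =>
    cases s with
    | word b => exact wordVal_append ι a b
    | jump u v s => simp only [append, val, wordVal_append, mul_assoc]
  | jump u v t ih => simp only [append, val, ih, mul_assoc]

theorem val_inv {S : Type v} [FInverseMonoid S] (ι : X → S) (t : FTerm X) :
    t.inv.val ι = (t.val ι)⁻¹ := by
  induction t with
  | word a => exact wordVal_invRev ι a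
  | jump a b t ih =>
    simp only [inv, val, val_append, ih, wordVal_invRev, wordVal, one_mul, FInverseMonoid.mx_inv,
      InverseMonoid.mul_inv_rev]

theorem groupVal_append {G : Type w} [Group G] (ι : X → G) (t s : FTerm X) :
    (t.append s).groupVal ι = t.groupVal ι * s.groupVal ι := by
  induction t with
  | word a =>
    cases s with
    | word b => exact wordVal_append ι a b
    | jump u v s => simp only [append, groupVal, wordVal_append, mul_assoc]
  | jump u v t ih => simp only [append, groupVal, ih, mul_assoc]

end FTerm

theorem generates_of_exists_val_eq {S : Type v} [FInverseMonoid S] {ι : X → S}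
    (h : ∀ s, ∃ t : FTerm X, t.val ι = s) : Generates ι := by
  intro T hgen hone hmul hinv hmx s
  have wordVal_mem (p : Word X) : wordVal ι p ∈ T := by
    induction p with
    | nil => exact hone
    | cons a p ih =>
      refine hmul _ ?_ _ ih
      obtain ⟨x, _ | _⟩ := a
      exacts [hinv _ (hgen x), hgen x]
  obtain ⟨t, rfl⟩ := h s
  induction t with
  | word p => exact wordVal_mem p
  | jump p q t ih => exact hmul _ (hmul _ (wordVal_mem p) _ (hmx _ (wordVal_mem q))) _ ih

end Terms

section Generation

variable {X : Type u} {S : Type v} [FInverseMonoid S] {G : Type w} [Group G] {ιS : X → S}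
  {ιG : X → G} {π : S →* G}

theorem map_letter (π : S →* G) (hπ : ∀ x, π (ιS x) = ιG x) (a : X × Bool) :
    π (letter ιS a) = letter ιG a := by
  rw [← wordVal_singleton, map_wordVal π hπ, wordVal_singleton]

theorem Generates.closure_range_eq_top (hS : Generates ιS) (hπ : ∀ x, π (ιS x) = ιG x)
    (hsurj : Function.Surjective π) : Subgroup.closure (Set.range ιG) = ⊤ := by
  refine (Subgroup.eq_top_iff' _).2 (hsurj.forall.2 ?_)
  refine hS {s | π s ∈ Subgroup.closure (Set.range ιG)} (fun x => ?_) ?_ (fun a ha b hb => ?_)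
    (fun a ha => ?_) (fun a ha => ?_)
  · exact Subgroup.subset_closure ⟨x, (hπ x).symm⟩
  · simp
  · simpa using mul_mem ha hb
  · simpa [map_inv'] using ha
  · simpa [map_mx] using ha

theorem Generates.exists_val_eq (hS : Generates ιS) (hπ : ∀ x, π (ιS x) = ιG x)
    (hG : IsGreatestGroupImage π) : ∀ s : S, ∃ t : FTerm X, t.val ιS = s := by
  refine hS {s | ∃ t : FTerm X, t.val ιS = s} (fun x => ?_) ⟨.word [], rfl⟩ ?_ ?_ fun s _ => ?_
  · exact ⟨.word [(x, true)], wordVal_singleton _ _⟩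
  · rintro _ ⟨t, rfl⟩ _ ⟨t', rfl⟩
    exact ⟨t.append t', FTerm.val_append _ _ _⟩
  · rintro _ ⟨t, rfl⟩
    exact ⟨t.inv, FTerm.val_inv _ _⟩
  · obtain ⟨p, hp⟩ := exists_wordVal_eq (hS.closure_range_eq_top hπ hG.1) (π s)
    have hσ : SigmaRel (wordVal ιS p) s := (hG.2 _ _).1 (by rw [map_wordVal π hπ, hp])
    refine ⟨.jump [] p (.word []), ?_⟩
    simp only [FTerm.val, wordVal, one_mul, mul_one, FInverseMonoid.mx_eq_of_sigmaRel hσ]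

end Generation

/-! ### Finite subgraphs and the spans of journeys -/

section Spans

variable {X : Type u} {G : Type w} [Group G] {ι : X → G}

namespace Subgr

theorem edge_le_iff {e : Edge X G} {Δ : Subgr ι} : edge ι e ≤ Δ ↔ e ∈ Δ.edges := by
  refine ⟨fun h => h.2 (Or.inl rfl), fun h => ⟨?_, ?_⟩⟩
  · rintro _ (rfl | rfl)
    exacts [Δ.src_mem _ h, Δ.tgt_mem _ h]
  · rintro _ (rfl | rfl)
    exacts [h, Δ.rev_mem _ h]

theorem edge_rev (e : Edge X G) : edge ι (Edge.rev ι e) = edge ι e :=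
  le_antisymm (edge_le_iff.2 (Or.inr rfl)) (edge_le_iff.2 (Or.inr (Edge.rev_rev ι e).symm))

theorem verts_nonempty {Δ : Subgr ι} (hΔ : Δ ≠ ⊥) : Δ.verts.Nonempty := by
  contrapose! hΔ
  refine Subgr.ext hΔ (Set.eq_empty_iff_forall_notMem.2 fun e he => ?_)
  exact Set.notMem_empty _ (hΔ ▸ Δ.src_mem e he)

theorem sSup_vert_union_edge (Δ : Subgr ι) :
    sSup (vert ι '' Δ.verts ∪ edge ι '' Δ.edges) = Δ := by
  refine le_antisymm (sSup_le ?_) ⟨fun g hg => ?_, fun e he => ?_⟩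
  · rintro _ (⟨g, hg, rfl⟩ | ⟨e, he, rfl⟩)
    exacts [vert_le_iff.2 hg, edge_le_iff.2 he]
  · exact ⟨_, Or.inl ⟨g, hg, rfl⟩, rfl⟩
  · exact ⟨_, Or.inr ⟨e, he, rfl⟩, Or.inl rfl⟩

theorem le_of_forall_isFinite_le {Δ Ξ : Subgr ι}
    (h : ∀ E : Subgr ι, E.IsFinite → E ≤ Δ → E ≤ Ξ) : Δ ≤ Ξ := by
  rw [← sSup_vert_union_edge Δ]
  refine sSup_le ?_
  rintro _ (⟨g, hg, rfl⟩ | ⟨e, he, rfl⟩)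
  exacts [h _ (vert_finite g) (vert_le_iff.2 hg), h _ (edge_finite e) (edge_le_iff.2 he)]

end Subgr

theorem pathSpan_singleton (g : G) (a : X × Bool) : pathSpan ι g [a] = Subgr.edge ι (g, a) :=
  sup_eq_left.2 (Subgr.vert_le_iff.2 (Or.inr rfl))

@[elab_as_elim]
theorem Subgr.IsFinite.induction_on {motive : Subgr ι → Prop} {F : Subgr ι} (hF : F.IsFinite)
    (bot : motive ⊥)
    (sup_pathSpan : ∀ F h p, motive F → motive (F ⊔ pathSpan ι h p)) : motive F := by
  rw [← F.sSup_vert_union_edge]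
  have hfin : (vert ι '' F.verts ∪ edge ι '' F.edges).Finite :=
    (hF.1.image _).union (hF.2.image _)
  refine Set.Finite.induction_on_subset _ hfin (by rwa [sSup_empty]) fun {E A} hE _ _ ih => ?_
  rw [sSup_insert, sup_comm]
  obtain ⟨g, -, rfl⟩ | ⟨e, -, rfl⟩ := hE
  · exact sup_pathSpan _ g [] ih
  · rw [← pathSpan_singleton]
    exact sup_pathSpan _ e.1 [e.2] ih

theorem pathSpan_append (g : G) (p q : Word X) :
    pathSpan ι g (p ++ q) = pathSpan ι g p ⊔ pathSpan ι (g * wordVal ι p) q := by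
  induction p generalizing g with
  | nil =>
    rw [List.nil_append, pathSpan, wordVal, mul_one]
    exact (sup_eq_right.2 (Subgr.vert_le_iff.2 (pathSpan_start_mem g q))).symm
  | cons a p ih => rw [List.cons_append, pathSpan, pathSpan, ih, wordVal, sup_assoc, mul_assoc]

theorem journeySpan_append (g : G) (t s : FTerm X) :
    journeySpan ι g (t.append s) = journeySpan ι g t ⊔ journeySpan ι (g * t.groupVal ι) s := by
  induction t generalizing g with
  | word a =>
    cases s with
    | word b => exact pathSpan_append g a b
    | jump u v s =>
      simp only [FTerm.append, journeySpan, FTerm.groupVal, pathSpan_append, wordVal_append,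
        sup_assoc, mul_assoc]
  | jump u v t ih =>
    simp only [FTerm.append, journeySpan, FTerm.groupVal, ih, sup_assoc, mul_assoc]

theorem journeySpan_finite (g : G) (t : FTerm X) : (journeySpan ι g t).IsFinite := by
  induction t generalizing g with
  | word a => exact pathSpan_finite a g
  | jump a b t ih => exact (pathSpan_finite a g).sup (ih _)

theorem exists_journeySpan_eq_sup (hι : Subgroup.closure (Set.range ι) = ⊤) {F : Subgr ι}
    (hF : F.IsFinite) (g : G) :
    ∃ t : FTerm X, journeySpan ι 1 t = Subgr.vert ι 1 ⊔ F ⊔ Subgr.vert ι g ∧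
      t.groupVal ι = g := by
  revert g
  refine hF.induction_on (fun g => ?_) fun F h p ih g => ?_
  · obtain ⟨p, rfl⟩ := exists_wordVal_eq hι g
    exact ⟨.jump [] p (.word []), by simp [journeySpan, pathSpan, wordVal],
      by simp [FTerm.groupVal, wordVal]⟩
  · obtain ⟨t, hspan, hval⟩ := ih h
    obtain ⟨q, hq⟩ := exists_wordVal_eq hι ((h * wordVal ι p)⁻¹ * g)
    have hh : Subgr.vert ι h ≤ pathSpan ι h p := Subgr.vert_le_iff.2 (pathSpan_start_mem h p)
    refine ⟨t.append (.jump p q (.word [])), ?_, ?_⟩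
    · rw [journeySpan_append, hspan, hval, one_mul, journeySpan, hq, mul_inv_cancel_left,
        journeySpan, pathSpan, ← sup_assoc, sup_assoc _ (Subgr.vert ι h), sup_eq_right.2 hh,
        ← sup_assoc]
    · rw [FTerm.groupVal_append, hval, FTerm.groupVal, hq, FTerm.groupVal, wordVal]
      group

theorem exists_journeySpan_eq (hι : Subgroup.closure (Set.range ι) = ⊤) {F : Subgr ι}
    (hF : F.IsFinite) {g : G} (hone : 1 ∈ F.verts) (hg : g ∈ F.verts) :
    ∃ t : FTerm X, journeySpan ι 1 t = F ∧ t.groupVal ι = g := by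
  have := exists_journeySpan_eq_sup hι hF g
  rwa [sup_eq_right.2 (Subgr.vert_le_iff.2 hone), sup_eq_left.2 (Subgr.vert_le_iff.2 hg)] at this

end Spans

/-! ### The closure operator of an `F`-inverse monoid -/

section ClosureOf

variable {X : Type u} {S : Type v} [FInverseMonoid S] {G : Type w} [Group G] {ιS : X → S}
  {ιG : X → G} {π : S →* G} (hπ : ∀ x, π (ιS x) = ιG x)

include hπ in
theorem groupVal_eq_of_val_eq {t t' : FTerm X} (h : t.val ιS = t'.val ιS) :
    t.groupVal ιG = t'.groupVal ιG := by
  rw [← map_val π hπ, ← map_val π hπ, h]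

theorem closureOf_isClosed_iff {Δ : Subgr ιG} :
    (closureOf ιS ιG π hπ).IsClosed Δ ↔ ∀ t t' : FTerm X, t.val ιS = t'.val ιS → ∀ g,
      journeySpan ιG g t ≤ Δ → journeySpan ιG g t' ≤ Δ := by
  change RelClosed _ Δ ↔ _
  constructor
  · intro hΔ t t' h g ht
    exact ((hΔ t t' h g (ht.1 (journeySpan_start_mem g t)) _
      (ht.1 (journeySpan_finish_mem t g))).1 ⟨ht, rfl⟩).1
  · intro hΔ t t' h g _ k _
    exact and_congr ⟨hΔ t t' h g, hΔ t' t h.symm g⟩ (by rw [groupVal_eq_of_val_eq hπ h])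

theorem FSchTerm_eq_of_val_eq {t t' : FTerm X} (h : t.val ιS = t'.val ιS) :
    FSchTerm ιS ιG π hπ t = FSchTerm ιS ιG π hπ t' := by
  have FSchTerm_le {t t' : FTerm X} (h : t.val ιS = t'.val ιS) :
      FSchTerm ιS ιG π hπ t' ≤ FSchTerm ιS ιG π hπ t :=
    ClosureOperator.closure_min
      ((closureOf_isClosed_iff hπ).1 (ClosureOperator.isClosed_closure _ _) t t' h 1
        (ClosureOperator.le_closure _ _))
      (ClosureOperator.isClosed_closure _ _)
  exact le_antisymm (FSchTerm_le h.symm) (FSchTerm_le h)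

theorem FSch_val (t : FTerm X) : FSch ιS ιG π hπ (t.val ιS) = FSchTerm ιS ιG π hπ t := by
  have ht : ∃ t' : FTerm X, t'.val ιS = t.val ιS := ⟨t, rfl⟩
  rw [FSch, dif_pos ht]
  exact FSchTerm_eq_of_val_eq hπ ht.choose_spec

end ClosureOf

/-! ### Schützenberger graphs -/

section SchutzenbergerGraph

variable {X : Type u} {S : Type v} [FInverseMonoid S] {G : Type w} [Group G] {ιS : X → S}
  {ιG : X → G} {π : S →* G} (hπ : ∀ x, π (ιS x) = ιG x)

/-- The image in the Cayley graph of `G` of the Schützenberger graph of `s`, which has the elements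
of the `𝓡`-class of `s` as vertices and an edge labeled `a` from `x` to `x a_S` whenever both
belong to that `𝓡`-class. -/
def schutzenbergerGraph (s : S) : Subgr ιG where
  verts := {g | ∃ x, GreenR s x ∧ π x = g}
  edges := {e | ∃ x, GreenR s x ∧ GreenR s (x * letter ιS e.2) ∧ π x = e.1}
  src_mem := fun _ ⟨x, hx, _, hπx⟩ => ⟨x, hx, hπx⟩
  tgt_mem := fun e ⟨x, _, hxe, hπx⟩ =>
    ⟨x * letter ιS e.2, hxe, by rw [map_mul, map_letter π hπ, hπx, Edge.tgt]⟩
  rev_mem := fun e ⟨x, hx, hxe, hπx⟩ =>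
    ⟨x * letter ιS e.2, hxe, by
      rw [Edge.rev, InverseMonoid.letter_not]
      exact hx.mul_mul_inv hxe, by rw [map_mul, map_letter π hπ, hπx, Edge.rev, Edge.tgt]⟩

variable {s x : S} (hG : IsGreatestGroupImage π) (hx : GreenR s x)
include hG hx

theorem edge_le_schutzenbergerGraph_iff {a : X × Bool} :
    Subgr.edge ιG (π x, a) ≤ schutzenbergerGraph hπ s ↔ GreenR s (x * letter ιS a) := by
  rw [Subgr.edge_le_iff]
  refine ⟨fun ⟨y, hy, hya, hπy⟩ => ?_, fun hxa => ⟨x, hx, hxa, rfl⟩⟩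
  rwa [(hx.symm.trans hy).eq_of_sigmaRel ((hG.2 _ _).1 hπy.symm)]

theorem pathSpan_le_schutzenbergerGraph_iff {p : Word X} :
    pathSpan ιG (π x) p ≤ schutzenbergerGraph hπ s ↔ GreenR s (x * wordVal ιS p) := by
  induction p generalizing x with
  | nil =>
    rw [pathSpan, wordVal, mul_one, Subgr.vert_le_iff]
    exact iff_of_true ⟨x, hx, rfl⟩ hx
  | cons a p ih =>
    rw [pathSpan, sup_le_iff, edge_le_schutzenbergerGraph_iff hπ hG hx, wordVal, ← mul_assoc,
      ← map_letter π hπ, ← map_mul]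
    exact ⟨fun ⟨hxa, hp⟩ => (ih hxa).1 hp,
      fun hxp => ⟨hx.mul_of_mul_mul hxp, (ih (hx.mul_of_mul_mul hxp)).2 hxp⟩⟩

theorem journeySpan_le_schutzenbergerGraph_iff {t : FTerm X} :
    journeySpan ιG (π x) t ≤ schutzenbergerGraph hπ s ↔ GreenR s (x * t.val ιS) := by
  induction t generalizing x with
  | word p => exact pathSpan_le_schutzenbergerGraph_iff hπ hG hx
  | jump p q t ih =>
    rw [journeySpan, sup_le_iff, pathSpan_le_schutzenbergerGraph_iff hπ hG hx, FTerm.val,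
      ← mul_assoc, ← mul_assoc, ← map_wordVal π hπ, ← map_wordVal π hπ, ← map_mul]
    constructor
    · rintro ⟨hxp, ht⟩
      -- The jump leads to a vertex of the graph, which can only be `x p_S (q_S)^𝔪`.
      obtain ⟨y, hy, hπy⟩ := ht.1 (journeySpan_start_mem _ t)
      have hjump := (hxp.symm.trans hy).mul_mx_eq hG hπy
      rw [hjump]
      rw [← hπy] at ht
      exact (ih hy).1 ht
    · intro hxt
      have hxp : GreenR s (x * wordVal ιS p) :=
        hx.mul_of_mul_mul (z := FInverseMonoid.mx (wordVal ιS q) * t.val ιS) (by rwa [← mul_assoc])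
      refine ⟨hxp, ?_⟩
      rw [← map_mx π (wordVal ιS q), ← map_mul]
      exact (ih (hxp.mul_of_mul_mul hxt)).2 hxt

omit hx in
theorem closureOf_isClosed_schutzenbergerGraph :
    (closureOf ιS ιG π hπ).IsClosed (schutzenbergerGraph hπ s) := by
  refine (closureOf_isClosed_iff hπ).2 fun t t' h g ht => ?_
  obtain ⟨x, hx, rfl⟩ := ht.1 (journeySpan_start_mem g t)
  rwa [journeySpan_le_schutzenbergerGraph_iff hπ hG hx, ← h,
    ← journeySpan_le_schutzenbergerGraph_iff hπ hG hx]

omit hx in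
theorem natLE_val_of_FSchTerm_le {t t' : FTerm X} (hval : π (t.val ιS) = π (t'.val ιS))
    (hle : FSchTerm ιS ιG π hπ t' ≤ FSchTerm ιS ιG π hπ t) : NatLE (t.val ιS) (t'.val ιS) := by
  set s := t.val ιS with hs
  have hx := GreenR.self_mul_inv s
  have hone : π (s * s⁻¹) = 1 := by rw [map_mul, map_inv', mul_inv_cancel]
  have mem_iff (w : FTerm X) : journeySpan ιG 1 w ≤ schutzenbergerGraph hπ s ↔
      GreenR s (s * s⁻¹ * w.val ιS) := by
    rw [← hone, journeySpan_le_schutzenbergerGraph_iff hπ hG hx]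
  have ht : FSchTerm ιS ιG π hπ t ≤ schutzenbergerGraph hπ s := by
    refine ClosureOperator.closure_min ((mem_iff t).2 ?_)
      (closureOf_isClosed_schutzenbergerGraph hπ hG)
    rw [← hs, InverseMonoid.mul_inv_mul]
    exact ⟨dvd_rfl, dvd_rfl⟩
  have ht' := (mem_iff t').1 (((ClosureOperator.le_closure _ _).trans hle).trans ht)
  exact ht'.eq_of_sigmaRel ((hG.2 _ _).1 (by rw [map_mul, hone, one_mul, hval]))

end SchutzenbergerGraph

/-! ### The `F`-inverse monoid of a closure operator -/

namespace ClosureMonoid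

variable {X : Type u} {G : Type w} [Group G] {ι : X → G} {c : InvClosure ι}

theorem graph_mx (a : ClosureMonoid c) :
    (FInverseMonoid.mx a).graph = c (Subgr.vert ι 1 ⊔ Subgr.vert ι a.elt) :=
  rfl

theorem elt_mx (a : ClosureMonoid c) : (FInverseMonoid.mx a).elt = a.elt :=
  rfl

theorem elt_letter_gen (a : X × Bool) : (letter (gen c) a).elt = letter ι a :=
  map_letter (proj c) (fun _ => rfl) a

theorem elt_wordVal_gen (p : Word X) : (wordVal (gen c) p).elt = wordVal ι p :=
  map_wordVal (proj c) (fun _ => rfl) p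

theorem elt_val_gen (t : FTerm X) : (t.val (gen c)).elt = t.groupVal ι :=
  map_val (proj c) (fun _ => rfl) t

theorem graph_letter_gen (a : X × Bool) : (letter (gen c) a).graph = c (Subgr.edge ι (1, a)) := by
  obtain ⟨x, _ | _⟩ := a
  · change (ι x)⁻¹ • c (pathSpan ι 1 [(x, true)]) = _
    rw [← c.map_smul, smul_pathSpan, mul_one, pathSpan_singleton, ← Subgr.edge_rev]
    simp [Edge.rev, Edge.tgt, letter]
  · change c (pathSpan ι 1 [(x, true)]) = _
    rw [pathSpan_singleton]

theorem graph_wordVal_gen (p : Word X) : (wordVal (gen c) p).graph = c (pathSpan ι 1 p) := by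
  induction p with
  | nil => rfl
  | cons a p ih =>
    rw [wordVal, graph_mul, graph_letter_gen, ih, elt_letter_gen, ← c.map_smul,
      c.closure_sup_closure, smul_pathSpan, mul_one, pathSpan, one_mul]

theorem graph_val_gen (t : FTerm X) : (t.val (gen c)).graph = c (journeySpan ι 1 t) := by
  induction t with
  | word p => exact graph_wordVal_gen p
  | jump p q t ih =>
    have hp : Subgr.vert ι (wordVal ι p) ≤ pathSpan ι 1 p :=
      Subgr.vert_le_iff.2 (by simpa using pathSpan_finish_mem (ι := ι) p 1)
    have ht := Subgr.vert_le_iff.2 (journeySpan_start_mem (ι := ι) (wordVal ι p * wordVal ι q) t)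
    calc (wordVal (gen c) p * FInverseMonoid.mx (wordVal (gen c) q) * t.val (gen c)).graph
      _ = c (pathSpan ι 1 p ⊔
            (Subgr.vert ι (wordVal ι p) ⊔ Subgr.vert ι (wordVal ι p * wordVal ι q)) ⊔
            journeySpan ι (wordVal ι p * wordVal ι q) t) := by
        rw [graph_mul, graph_mul, elt_mul, elt_mx, graph_mx, ih, graph_wordVal_gen,
          elt_wordVal_gen, elt_wordVal_gen, ← c.map_smul, ← c.map_smul,
          c.closure_sup_closure (pathSpan ι 1 p),
          c.closure_sup_closure, smul_journeySpan, Subgr.smul_sup, Subgr.smul_vert,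
          Subgr.smul_vert, mul_one, mul_one]
      _ = c (journeySpan ι 1 (.jump p q t)) := by
        rw [← sup_assoc, sup_eq_left.2 hp, sup_assoc, sup_eq_right.2 ht, journeySpan, one_mul]

theorem exists_val_gen_eq (hι : Subgroup.closure (Set.range ι) = ⊤) (a : ClosureMonoid c) :
    ∃ t : FTerm X, t.val (gen c) = a := by
  obtain ⟨F, hF, hFa⟩ := a.compact
  obtain ⟨t, hspan, hval⟩ := exists_journeySpan_eq_sup hι hF a.elt
  refine ⟨t, ClosureMonoid.ext ?_ ((elt_val_gen t).trans hval)⟩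
  have hone := Subgr.vert_le_iff.2 a.one_mem
  have helt := Subgr.vert_le_iff.2 a.elt_mem
  rw [graph_val_gen, hspan, sup_right_comm, ← c.closure_sup_closure_right, ← hFa,
    sup_eq_right.2 (sup_le hone helt), a.closure_graph]

theorem generates_gen (hι : Subgroup.closure (Set.range ι) = ⊤) : Generates (gen c) :=
  generates_of_exists_val_eq (exists_val_gen_eq hι)

theorem isGreatestGroupImage_proj (c : InvClosure ι) : IsGreatestGroupImage (proj c) := by
  refine ⟨fun g => ⟨top c g, rfl⟩, fun a b => ⟨fun h => ?_, elt_eq_of_sigma⟩⟩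
  change a.elt = b.elt at h
  have hle : a.graph ⊔ b.graph ≤ (a * a⁻¹ * b).graph := by
    rw [graph_mul, graph_mul_inv, elt_mul_inv, one_smul]
    exact c.le_closure _
  have helt : (a * a⁻¹ * b).elt = b.elt := by rw [elt_mul, elt_mul_inv, one_mul]
  exact ⟨a * a⁻¹ * b, natLE_iff.2 ⟨helt.trans h.symm, le_sup_left.trans hle⟩,
    natLE_iff.2 ⟨helt, le_sup_right.trans hle⟩⟩

theorem closure_le (c : InvClosure ι) (Δ : Subgr ι) : closure c Δ ≤ c Δ := by
  refine ClosureOperator.closure_min (c.le_closure Δ) ((closureOf_isClosed_iff _).2 ?_)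
  intro t t' h g
  have journeySpan_le_iff (w : FTerm X) :
      journeySpan ι g w ≤ c Δ ↔ g • (w.val (gen c)).graph ≤ c Δ := by
    rw [graph_val_gen, ← c.map_smul, smul_journeySpan, mul_one, c.le_closure_iff]
  rw [journeySpan_le_iff, journeySpan_le_iff, h]
  exact id

theorem le_closure_of_isFinite_of_one_mem (hι : Subgroup.closure (Set.range ι) = ⊤) {F : Subgr ι}
    (hF : F.IsFinite) (hone : 1 ∈ F.verts) : c F ≤ closure c F := by
  refine Subgr.le_of_forall_isFinite_le fun E hE hEF => ?_
  obtain ⟨t, hspan, hval⟩ := exists_journeySpan_eq hι hF hone hone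
  obtain ⟨t', hspan', hval'⟩ :=
    exists_journeySpan_eq hι (hF.sup hE) (g := 1) (Or.inl hone) (Or.inl hone)
  have hgen : t.val (gen c) = t'.val (gen c) := by
    refine ClosureMonoid.ext ?_ (by rw [elt_val_gen, elt_val_gen, hval, hval'])
    rw [graph_val_gen, graph_val_gen, hspan, hspan']
    exact le_antisymm (c.monotone le_sup_left)
      (c.le_closure_iff.1 (sup_le (c.le_closure F) hEF))
  have hclosed := (closureOf_isClosed_iff _).1 ((closure c).isClosed_closure F) t t' hgen 1
  rw [hspan, hspan'] at hclosed
  exact le_sup_right.trans (hclosed ((closure c).le_closure F))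

theorem le_closure_of_isFinite (hι : Subgroup.closure (Set.range ι) = ⊤) {F : Subgr ι}
    (hF : F.IsFinite) {g : G} (hg : g ∈ F.verts) : c F ≤ closure c F := by
  have hone : 1 ∈ (g⁻¹ • F).verts := by rwa [Subgr.mem_verts_smul, inv_inv, mul_one]
  have := le_closure_of_isFinite_of_one_mem (c := c) hι (hF.smul g⁻¹) hone
  rwa [c.map_smul, (closure c).map_smul, Subgr.smul_le_iff, inv_inv, smul_inv_smul] at this

theorem closure_eq (hι : Subgroup.closure (Set.range ι) = ⊤) (hc : c.Finitary) {Δ : Subgr ι}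
    (hΔ : Δ ≠ ⊥) : c Δ = closure c Δ := by
  refine le_antisymm ?_ (closure_le c Δ)
  obtain ⟨g, hg⟩ := Subgr.verts_nonempty hΔ
  rw [hc Δ]
  refine sSup_le ?_
  rintro _ ⟨F, hFΔ, hF, rfl⟩
  calc c F ≤ c (F ⊔ Subgr.vert ι g) := c.monotone le_sup_left
    _ ≤ closure c (F ⊔ Subgr.vert ι g) :=
      le_closure_of_isFinite hι (hF.sup (Subgr.vert_finite g)) (Or.inr rfl)
    _ ≤ closure c Δ := (closure c).monotone (sup_le hFΔ (Subgr.vert_le_iff.2 hg))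

theorem closure_toClosureOperator_eq (hι : Subgroup.closure (Set.range ι) = ⊤) (hc : c.Finitary)
    (hbot : c ⊥ = ⊥) : c.toClosureOperator = (closure c).toClosureOperator := by
  refine ClosureOperator.ext _ _ fun Δ => ?_
  rcases eq_or_ne Δ ⊥ with rfl | hΔ
  · exact hbot.trans (le_bot_iff.1 ((closure_le c ⊥).trans hbot.le)).symm
  · exact closure_eq hι hc hΔ

end ClosureMonoid

/-! ### The isomorphism onto `S_{c_S}` -/

section Isomorphism

variable {X : Type u} {S : Type v} [FInverseMonoid S] {G : Type w} [Group G] {ιS : X → S}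
  {ιG : X → G} {π : S →* G} (hπ : ∀ x, π (ιS x) = ιG x) (hS : Generates ιS)
  (hG : IsGreatestGroupImage π)

/-- The map `ψ : s ↦ (FΓ(s), sσ)` of the proposition. -/
noncomputable def toClosureMonoid (s : S) : ClosureMonoid (closureOf ιS ιG π hπ) where
  graph := FSch ιS ιG π hπ s
  elt := π s
  compact := by
    obtain ⟨t, rfl⟩ := hS.exists_val_eq hπ hG s
    exact ⟨_, journeySpan_finite 1 t, FSch_val hπ t⟩
  one_mem := by
    obtain ⟨t, rfl⟩ := hS.exists_val_eq hπ hG s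
    rw [FSch_val]
    exact ((closureOf ιS ιG π hπ).le_closure _).1 (journeySpan_start_mem 1 t)
  elt_mem := by
    obtain ⟨t, rfl⟩ := hS.exists_val_eq hπ hG s
    rw [FSch_val, map_val π hπ, ← one_mul (t.groupVal ιG)]
    exact ((closureOf ιS ιG π hπ).le_closure _).1 (journeySpan_finish_mem t 1)

theorem toClosureMonoid_val (t : FTerm X) :
    toClosureMonoid hπ hS hG (t.val ιS) = t.val (ClosureMonoid.gen (closureOf ιS ιG π hπ)) :=
  ClosureMonoid.ext ((FSch_val hπ t).trans (ClosureMonoid.graph_val_gen t).symm)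
    ((map_val π hπ t).trans (ClosureMonoid.elt_val_gen t).symm)

theorem toClosureMonoid_gen (x : X) :
    toClosureMonoid hπ hS hG (ιS x) = ClosureMonoid.gen (closureOf ιS ιG π hπ) x := by
  simpa [FTerm.val, wordVal, letter] using toClosureMonoid_val hπ hS hG (.word [(x, true)])

theorem toClosureMonoid_mul (s s' : S) :
    toClosureMonoid hπ hS hG (s * s') =
      toClosureMonoid hπ hS hG s * toClosureMonoid hπ hS hG s' := by
  obtain ⟨t, rfl⟩ := hS.exists_val_eq hπ hG s
  obtain ⟨t', rfl⟩ := hS.exists_val_eq hπ hG s'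
  simp only [← FTerm.val_append, toClosureMonoid_val]

theorem toClosureMonoid_injective : Function.Injective (toClosureMonoid hπ hS hG) := by
  intro s s' h
  obtain ⟨t, rfl⟩ := hS.exists_val_eq hπ hG s
  obtain ⟨t', rfl⟩ := hS.exists_val_eq hπ hG s'
  have helt : π (t.val ιS) = π (t'.val ιS) := congrArg ClosureMonoid.elt h
  have hgraph : FSchTerm ιS ιG π hπ t = FSchTerm ιS ιG π hπ t' := by
    rw [← FSch_val, ← FSch_val]
    exact congrArg ClosureMonoid.graph h
  exact (natLE_val_of_FSchTerm_le hπ hG helt hgraph.ge).antisymm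
    (natLE_val_of_FSchTerm_le hπ hG helt.symm hgraph.le)

theorem toClosureMonoid_surjective : Function.Surjective (toClosureMonoid hπ hS hG) := by
  intro a
  obtain ⟨t, rfl⟩ := ClosureMonoid.exists_val_gen_eq (hS.closure_range_eq_top hπ hG.1) a
  exact ⟨t.val ιS, toClosureMonoid_val hπ hS hG t⟩

/-- The map `ψ` as an isomorphism of `S` onto `S_{c_S}`. -/
noncomputable def closureMonoidEquiv : S ≃* ClosureMonoid (closureOf ιS ιG π hπ) where
  __ := Equiv.ofBijective (toClosureMonoid hπ hS hG)
    ⟨toClosureMonoid_injective hπ hS hG, toClosureMonoid_surjective hπ hS hG⟩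
  map_mul' := toClosureMonoid_mul hπ hS hG

end Isomorphism

end FInv

theorem mainTheorem2 {X : Type u} :
    (∀ (S : Type v) [FInverseMonoid S] (G : Type w) [Group G] (ιS : X → S) (ιG : X → G)
        (π : S →* G) (hπ : ∀ x, π (ιS x) = ιG x),
        Generates ιS → IsGreatestGroupImage π →
        (∀ t : FTerm X, FSch ιS ιG π hπ (t.val ιS) = FSchTerm ιS ιG π hπ t) ∧
        ∃ ψ : S ≃* ClosureMonoid (closureOf ιS ιG π hπ),
          (∀ s, (ψ s).graph = FSch ιS ιG π hπ s ∧ (ψ s).elt = π s) ∧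
          (∀ s, ψ s⁻¹ = (ψ s)⁻¹) ∧
          (∀ s, ψ (FInverseMonoid.mx s) = FInverseMonoid.mx (ψ s)) ∧
          (∀ x, ψ (ιS x) = ClosureMonoid.gen (closureOf ιS ιG π hπ) x)) ∧
    (∀ (G : Type w) [Group G] (ι : X → G), Subgroup.closure (Set.range ι) = ⊤ →
        ∀ c : InvClosure ι, c.Finitary →
          Generates (ClosureMonoid.gen c) ∧ IsGreatestGroupImage (ClosureMonoid.proj c) ∧
          (∀ Δ : Subgr ι, Δ ≠ ⊥ → c Δ = ClosureMonoid.closure c Δ) ∧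
          (c ⊥ = ⊥ →
            c.toClosureOperator = (ClosureMonoid.closure c).toClosureOperator)) := by
  refine ⟨fun S _ G _ ιS ιG π hπ hS hG => ?_, fun G _ ι hι c hc => ?_⟩
  · exact ⟨FSch_val hπ, closureMonoidEquiv hπ hS hG, fun _ => ⟨rfl, rfl⟩,
      InverseMonoid.map_inv _, FInverseMonoid.map_mx _, toClosureMonoid_gen hπ hS hG⟩
  · exact ⟨ClosureMonoid.generates_gen hι, ClosureMonoid.isGreatestGroupImage_proj c,
      fun _ => ClosureMonoid.closure_eq hι hc, ClosureMonoid.closure_toClosureOperator_eq hι hc⟩
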